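/- Let $f$ be holomorphic on the strip $\mathcal D_d=\{z\in\mathbb C: |\operatorname{Im} z|<d\}$, $d>0$, and suppose that for some constants $A$ and $B,\gamma_L,\gamma_R>0$ $$|f(x)|\le A\exp\!\left(-Be^{\gamma_L|x|}\right)\ (x\le 0),\qquad |f(x)|\le A\exp\!\left(-Be^{\gamma_R|x|}\right)\ (x\ge 0).$$ Put $\gamma=\max\{\gamma_L,\gamma_R\}$ and assume $d<\pi/(2\gamma)$ and $f\in\mathbf B_2(\mathcal D_d)$, that is, $\int_{-d}^{d}|f(x+iy)|\,dy\to0$ as $|x|\to\infty$, and $$\lim_{\varepsilon\to0^+}\Big(\int_{|\operatorname{Im}z|=d(1-\varepsilon)}|f(z)|^2\,|dz|\Big)^{1/2}$$ exists and is finite. Assume moreover that $f(0)$ and $f'(0)$ are not both zero, unless $f\equiv0$ on $\mathbb R$ (this holds, for instance, if $f$ solves on $\mathbb R$ an equation $f''=qf$ with $q$ continuous). Fix an integer $N\ge1$. For $h>0$ and $k\in\mathbb Z$ let $S(k,h)(x)=\operatorname{sinc}(x/h-k)$ with $\operatorname{sinc}(x)=\sin(\pi x)/(\pi x)$, $\operatorname{sinc}(0)=1$.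 Let $\alpha\in\mathbb R$, and suppose that scaling by a factor $\tau>0$ replaces $B$ by $B_S=\tau^{\alpha}B$, so that the mesh size is $$h(\tau)=\frac{W(\pi d\gamma N/B_S)}{\gamma N},$$ where $W$ is the (principal) Lambert $W$ function. Let $$E_N(\tau)=\Big\|f''-\sum_{k=-N}^{N}f(kh(\tau))\,S''(k,h(\tau))\Big\|_{L^2(\mathbb R)}.$$ Then for every reference factor $\tau_0>0$ (in particular $\tau_0=1$, no scaling), the set of scaling factors $\tau>0$ that decrease the error, $\{\tau>0: E_N(\tau)<E_N(\tau_0)\}$, is bounded in $\mathbb R$ if $\alpha\ge0$. If $\alpha<0$, in which case $B_S$ increases as $\tau$ decreases, this set is bounded away from $0$. -/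

import Mathlib

namespace SincScaling

noncomputable section

/-- The normalized sinc function `sin (π x) / (π x)`, with value `1` at `0`. -/
def sinc (x : ℝ) : ℝ := Real.sinc (Real.pi * x)

/-- The shifted Sinc function `S(j,h)(x) = sinc (x / h - j)`. -/
def S (j : ℤ) (h : ℝ) (x : ℝ) : ℝ := sinc (x / h - j)

/-- The open strip `{z : |Im z| < d}`. -/
def strip (d : ℝ) : Set ℂ := {z | |z.im| < d}

/-- The quantity whose limit as `ε → 0` is `N_p(g, D_d)`. For `p < ∞` it is the `L^p` norm of `g`
on the boundary of `{|Im z| < d (1 - ε)}`, that is, on the two lines `Im z = ± d (1 - ε)`;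
for `p = ∞` it is the supremum of `|g|` over `{|Im z| < d (1 - ε)}`. -/
def stripNorm (p : ENNReal) (g : ℂ → ℂ) (d ε : ℝ) : ENNReal :=
  if p = ⊤ then ⨆ z ∈ strip (d * (1 - ε)), ‖g z‖ₑ
  else
    ((∫⁻ x : ℝ, ‖g (⟨x, d * (1 - ε)⟩ : ℂ)‖ₑ ^ p.toReal) +
      ∫⁻ x : ℝ, ‖g (⟨x, -(d * (1 - ε))⟩ : ℂ)‖ₑ ^ p.toReal) ^ (1 / p.toReal)

/-- The function space `B_p(D_d)`, for `1 ≤ p ≤ ∞`. -/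
structure MemB (p : ENNReal) (d : ℝ) (g : ℂ → ℂ) : Prop where
  holomorphic : DifferentiableOn ℂ g (strip d)
  vertical :
    Filter.Tendsto (fun x : ℝ => ∫⁻ y in Set.Ioo (-d) d, ‖g (⟨x, y⟩ : ℂ)‖ₑ)
      (Filter.cocompact ℝ) (nhds 0)
  boundary :
    ∃ L : ENNReal, L < ⊤ ∧
      Filter.Tendsto (fun ε : ℝ => stripNorm p g d ε) (nhdsWithin 0 (Set.Ioi 0)) (nhds L)

/-- The principal branch of the Lambert W function: for `z ≥ -1/e`, the unique `w ≥ -1` with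
`w * exp w = z`. -/
def lambertW (z : ℝ) : ℝ :=
  Function.invFunOn (fun w : ℝ => w * Real.exp w) (Set.Ici (-1)) z

/-- The mesh size `h = W(π d γ N / B) / (γ N)`. -/
def meshSize (d γ B : ℝ) (N : ℕ) : ℝ :=
  lambertW (Real.pi * d * γ * N / B) / (γ * N)

/-- The `L²(ℝ)` error between `f''` and the second derivative of the truncated Sinc expansion
`∑_{|k| ≤ N} f(kh) S(k,h)` of `f`. -/
def sincError (f : ℂ → ℂ) (N : ℕ) (h : ℝ) : ENNReal :=
  MeasureTheory.eLpNorm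
    (fun x : ℝ =>
      iteratedDeriv 2 (fun t : ℝ => f (t : ℂ)) x -
        ∑ k ∈ Finset.Icc (-(N : ℤ)) (N : ℤ),
          f (((k : ℝ) * h : ℝ) : ℂ) * ((iteratedDeriv 2 (S k h) x : ℝ) : ℂ))
    2 MeasureTheory.volume

end

end SincScaling

namespace SincScaling

open Filter Topology MeasureTheory

/-! ### The second derivative of the sinc function -/

/-! The error cannot drop below a given value once the mesh size `h` is small. Substituting `y = π x
/ h`, the second derivative of the truncated expansion has `L²` norm `(π / h) ^ (3 / 2)` times that
of `∑ f (k h) sinc'' (y - π k)`. As `h → 0` the coefficients tend to `f 0`, or, if `f 0 = 0`, after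
division by `h` to `k * f' 0`. The limit combination is nonzero by linear independence, so the norm
blows up like `h ^ (-3 / 2)` or `h ^ (-1 / 2)` (`tendsto_eLpNorm_sincSum_of_differentiableAt`),
while `f''` is fixed (`eventually_sincError_le`). Finally `h → 0` as `B τ ^ α → ∞`
(`tendsto_meshSize`), that is, as `τ → ∞` for `α > 0` and as `τ → 0` for `α < 0`. -/

theorem contDiff_sinc {n : WithTop ℕ∞} : ContDiff ℝ n Real.sinc := by
  refine contDiff_iff_contDiffAt.2 fun x => AnalyticAt.contDiffAt ?_
  by_cases hx : x = 0
  · subst hx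
    obtain ⟨p, hp⟩ := Real.analyticAt_sin (x := 0)
    rw [Real.sinc_eq_dslope]
    exact hp.has_fpower_series_dslope_fslope.analyticAt
  · have h : AnalyticAt ℝ (fun y : ℝ => Real.sin y / y) x :=
      Real.analyticAt_sin.div analyticAt_id hx
    refine h.congr ?_
    filter_upwards [isOpen_ne.mem_nhds hx] with y hy
    exact (Real.sinc_of_ne_zero hy).symm

theorem mul_sinc (y : ℝ) : y * Real.sinc y = Real.sin y := by
  by_cases hy : y = 0
  · simp [hy]
  · rw [Real.sinc_of_ne_zero hy]; field_simp

theorem differentiable_sinc : Differentiable ℝ Real.sinc :=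
  (contDiff_sinc (n := 1)).differentiable one_ne_zero

theorem differentiable_deriv_sinc : Differentiable ℝ (deriv Real.sinc) := by
  have := (contDiff_sinc (n := 2)).differentiable_iteratedDeriv 1 (by norm_num)
  rwa [iteratedDeriv_one] at this

theorem continuous_iteratedDeriv_two_sinc : Continuous (iteratedDeriv 2 Real.sinc) :=
  (contDiff_sinc (n := 2)).continuous_iteratedDeriv 2 le_rfl

/-- Differentiating `y * sinc y = sin y` avoids quotients and a separate case at `0`. -/
theorem sinc_add_mul_deriv_sinc (y : ℝ) :
    Real.sinc y + y * deriv Real.sinc y = Real.cos y := by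
  have h := (hasDerivAt_id y).mul (differentiable_sinc y).hasDerivAt
  have h' : HasDerivAt Real.sin (Real.sinc y + y * deriv Real.sinc y) y := by
    have e : (id * Real.sinc) = Real.sin := funext fun z => mul_sinc z
    rw [e] at h
    simpa using h
  exact h'.unique (Real.hasDerivAt_sin y)

theorem two_mul_deriv_sinc_add_mul_iteratedDeriv (y : ℝ) :
    2 * deriv Real.sinc y + y * iteratedDeriv 2 Real.sinc y = -Real.sin y := by
  have h := (differentiable_sinc y).hasDerivAt.add
    ((hasDerivAt_id y).mul (differentiable_deriv_sinc y).hasDerivAt)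
  have e : (Real.sinc + id * deriv Real.sinc) = Real.cos :=
    funext fun z => sinc_add_mul_deriv_sinc z
  rw [e] at h
  have h2 := h.unique (Real.hasDerivAt_cos y)
  rw [iteratedDeriv_succ, iteratedDeriv_one]
  simp only [id, one_mul] at h2
  linarith

/-- Decay of order `1 / |y|` suffices for square integrability. The constant is `2 * 2 + 1`, from `2
|sinc'| + |sin|`. -/
theorem abs_mul_iteratedDeriv_two_sinc_le {y : ℝ} (hy : 1 ≤ |y|) :
    |y * iteratedDeriv 2 Real.sinc y| ≤ 5 := by
  have h1 := sinc_add_mul_deriv_sinc y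
  have h2 := two_mul_deriv_sinc_add_mul_iteratedDeriv y
  have h3 : |y * deriv Real.sinc y| ≤ 2 := by
    have := abs_le.1 (Real.abs_sinc_le_one y)
    have := abs_le.1 (Real.abs_cos_le_one y)
    exact abs_le.2 ⟨by linarith, by linarith⟩
  have h4 : |deriv Real.sinc y| ≤ 2 := by
    rw [abs_mul] at h3
    nlinarith [abs_nonneg (deriv Real.sinc y)]
  have := abs_le.1 h4
  have := abs_le.1 (Real.abs_sin_le_one y)
  exact abs_le.2 ⟨by linarith, by linarith⟩

theorem memLp_iteratedDeriv_two_sinc : MemLp (iteratedDeriv 2 Real.sinc) 2 := by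
  have hc := continuous_iteratedDeriv_two_sinc
  rw [memLp_two_iff_integrable_sq hc.aestronglyMeasurable]
  obtain ⟨C, hC⟩ := isCompact_Icc.exists_bound_of_continuousOn
    (hc.continuousOn (s := Set.Icc (-1) 1))
  -- The factor `1 + y ^ 2` is at most `2` for `|y| ≤ 1` and at most `2 * y ^ 2` otherwise, giving
  -- `2 * C ^ 2` and `2 * 25`.
  refine Integrable.mono' (integrable_inv_one_add_sq.const_mul (2 * C ^ 2 + 50))
    (hc.pow 2).aestronglyMeasurable (Eventually.of_forall fun y => ?_)
  rw [Real.norm_of_nonneg (sq_nonneg _), ← div_eq_mul_inv, le_div_iff₀ (by positivity)]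
  by_cases hy : |y| ≤ 1
  · have h := hC y (abs_le.1 hy)
    rw [Real.norm_eq_abs] at h
    have h2 : iteratedDeriv 2 Real.sinc y ^ 2 ≤ C ^ 2 := by
      rw [← sq_abs]; gcongr
    have h3 : y ^ 2 ≤ 1 := by rw [← sq_abs]; exact pow_le_one₀ (abs_nonneg _) hy
    nlinarith [sq_nonneg (iteratedDeriv 2 Real.sinc y)]
  · have hy' : 1 ≤ |y| := (not_le.1 hy).le
    have h := abs_mul_iteratedDeriv_two_sinc_le hy'
    have h2 : (y * iteratedDeriv 2 Real.sinc y) ^ 2 ≤ 25 := by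
      rw [← sq_abs]; nlinarith [abs_nonneg (y * iteratedDeriv 2 Real.sinc y)]
    have h3 : 1 ≤ y ^ 2 := by rw [← sq_abs]; exact one_le_pow₀ hy'
    nlinarith [sq_nonneg (iteratedDeriv 2 Real.sinc y), sq_nonneg C]

theorem sinc_int_mul_pi {n : ℤ} (hn : n ≠ 0) : Real.sinc (n * Real.pi) = 0 := by
  rw [Real.sinc_of_ne_zero (by positivity), Real.sin_int_mul_pi, zero_div]

/-- The second derivatives of finitely many integer shifts of the sinc function are linearly
independent. -/
theorem eq_zero_of_sum_iteratedDeriv_two_sinc_eq_zero (N : ℕ) (c : ℤ → ℝ)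
    (h : ∀ x : ℝ, ∑ k ∈ Finset.Icc (-(N : ℤ)) N,
      c k * iteratedDeriv 2 Real.sinc (x - Real.pi * k) = 0)
    {j : ℤ} (hj : j ∈ Finset.Icc (-(N : ℤ)) N) : c j = 0 := by
  set ψ : ℝ → ℝ := fun x => ∑ k ∈ Finset.Icc (-(N : ℤ)) N,
    c k * Real.sinc (x - Real.pi * k) with hψ
  set φ : ℝ → ℝ := fun x => ∑ k ∈ Finset.Icc (-(N : ℤ)) N,
    c k * deriv Real.sinc (x - Real.pi * k) with hφ
  have hψφ : ∀ x, HasDerivAt ψ (φ x) x := fun x =>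
    HasDerivAt.fun_sum fun k _ =>
      ((differentiable_sinc _).hasDerivAt.comp_sub_const x (Real.pi * k)).const_mul (c k)
  have hφ0 : ∀ x, HasDerivAt φ 0 x := fun x => by
    have : HasDerivAt φ (∑ k ∈ Finset.Icc (-(N : ℤ)) N,
        c k * deriv (deriv Real.sinc) (x - Real.pi * k)) x :=
      HasDerivAt.fun_sum fun k _ =>
        ((differentiable_deriv_sinc _).hasDerivAt.comp_sub_const x (Real.pi * k)).const_mul (c k)
    have hx := h x
    rw [iteratedDeriv_succ, iteratedDeriv_one] at hx
    rwa [hx] at this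
  have hφc : ∀ x, φ x = φ 0 := fun x =>
    is_const_of_deriv_eq_zero (fun x => (hφ0 x).differentiableAt) (fun x => (hφ0 x).deriv) x 0
  -- The hypothesis says `ψ'' = 0`, so `ψ` is affine.
  have haff : ∀ x, ψ x = ψ 0 + φ 0 * x := fun x => by
    have hd : ∀ x, HasDerivAt (fun x => ψ x - φ 0 * x) 0 x := fun x => by
      have := (hψφ x).sub ((hasDerivAt_id x).const_mul (φ 0))
      simpa [hφc x] using! this
    have := is_const_of_deriv_eq_zero (fun x => (hd x).differentiableAt)
      (fun x => (hd x).deriv) x 0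
    simp only [mul_zero, sub_zero] at this
    linarith
  have hval : ∀ n : ℤ, ψ (Real.pi * n) = if n ∈ Finset.Icc (-(N : ℤ)) N then c n else 0 := by
    intro n
    rw [← Finset.sum_ite_eq]
    refine Finset.sum_congr rfl fun k _ => ?_
    split_ifs with hnk
    · simp [hnk]
    · have : Real.pi * n - Real.pi * k = ((n - k : ℤ) : ℝ) * Real.pi := by push_cast; ring
      rw [this, sinc_int_mul_pi (sub_ne_zero.2 hnk), mul_zero]
  -- Two nodes beyond the range are zeros of the affine `ψ`, so `ψ = 0`; its value at node `j` is `c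
  -- j`.
  have h1 := hval (N + 1)
  have h2 := hval (N + 2)
  rw [if_neg (by simp), haff] at h1 h2
  push_cast at h1 h2
  have ha : φ 0 * Real.pi = 0 := by linarith
  have ha0 : φ 0 = 0 := (mul_eq_zero.1 ha).resolve_right Real.pi_ne_zero
  have hj' := hval j
  rw [if_pos hj, haff] at hj'
  rw [ha0] at h1 hj'
  linarith

/-! ### Blow-up of the truncated sinc expansion as the mesh size tends to zero -/

/-- The second derivative of the truncated sinc expansion of `f`. -/
noncomputable def sincSum (f : ℂ → ℂ) (N : ℕ) (h x : ℝ) : ℂ :=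
  ∑ k ∈ Finset.Icc (-(N : ℤ)) (N : ℤ),
    f (((k : ℝ) * h : ℝ) : ℂ) * ((iteratedDeriv 2 (S k h) x : ℝ) : ℂ)

/-- A linear combination of the second derivatives of `sinc (· - π k)`, `|k| ≤ N`. -/
noncomputable def shiftSum (N : ℕ) (c : ℤ → ℂ) (x : ℝ) : ℂ :=
  ∑ k ∈ Finset.Icc (-(N : ℤ)) (N : ℤ),
    c k * ((iteratedDeriv 2 Real.sinc (x - Real.pi * k) : ℝ) : ℂ)

theorem continuous_shiftSum (N : ℕ) (c : ℤ → ℂ) : Continuous (shiftSum N c) := by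
  have := continuous_iteratedDeriv_two_sinc
  unfold shiftSum
  fun_prop

theorem memLp_shiftSum (N : ℕ) (c : ℤ → ℂ) : MemLp (shiftSum N c) 2 := by
  refine memLp_finsetSum _ fun k _ => MemLp.const_mul ?_ (c k)
  exact (memLp_iteratedDeriv_two_sinc.comp_measurePreserving
    (measurePreserving_sub_right volume (Real.pi * k))).ofReal

theorem iteratedDeriv_two_S (k : ℤ) (h x : ℝ) :
    iteratedDeriv 2 (S k h) x =
      (Real.pi / h) ^ 2 * iteratedDeriv 2 Real.sinc (Real.pi / h * x - Real.pi * k) := by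
  have e : S k h = fun y => (fun t => Real.sinc (t - Real.pi * k)) (Real.pi / h * y) := by
    funext y
    simp only [S, sinc]
    congr 1
    ring
  have hc : ContDiff ℝ 2 fun t => Real.sinc (t - Real.pi * k) :=
    contDiff_sinc.comp (contDiff_id.sub contDiff_const)
  rw [e, iteratedDeriv_comp_const_mul hc, iteratedDeriv_comp_sub_const]

/-- The free factor `r` normalises the coefficients so that they can have a nonzero limit as `h →
0`. -/
theorem sincSum_eq (f : ℂ → ℂ) (N : ℕ) (h : ℝ) {r : ℝ} (hr : r ≠ 0) :
    sincSum f N h = ((Real.pi / h) ^ 2 * r) • fun x =>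
      shiftSum N (fun k => f (((k : ℝ) * h : ℝ) : ℂ) / r) (Real.pi / h * x) := by
  funext x
  have hr' : (r : ℂ) ≠ 0 := by exact_mod_cast hr
  simp only [sincSum, shiftSum, Pi.smul_apply, Complex.real_smul, Finset.mul_sum]
  refine Finset.sum_congr rfl fun k _ => ?_
  rw [iteratedDeriv_two_S]
  push_cast
  field_simp

theorem eLpNorm_two_comp_mul_left {g : ℝ → ℂ} (hg : Continuous g) {a : ℝ} (ha : 0 < a) :
    eLpNorm (fun x => g (a * x)) 2 volume =
      ENNReal.ofReal (a ^ (-(1 / 2) : ℝ)) * eLpNorm g 2 volume := by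
  have h := eLpNorm_map_measure (p := 2) (μ := volume) (f := fun x : ℝ => a * x) (g := g)
    hg.aestronglyMeasurable (by fun_prop)
  change _ = eLpNorm (fun x => g (a * x)) 2 volume at h
  rw [← h, Real.map_volume_mul_left ha.ne', eLpNorm_smul_measure_of_ne_top (by simp), smul_eq_mul]
  congr 1
  rw [abs_of_pos (by positivity), ENNReal.ofReal_rpow_of_pos (by positivity)]
  congr 1
  rw [Real.rpow_neg ha.le, Real.inv_rpow ha.le]
  simp

/-- The exponent is `2` from the chain rule minus `1 / 2` from the change of variable in `L²`. -/
theorem eLpNorm_sincSum (f : ℂ → ℂ) (N : ℕ) {h r : ℝ} (hh : 0 < h) (hr : 0 < r) :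
    eLpNorm (sincSum f N h) 2 volume = ENNReal.ofReal ((Real.pi / h) ^ (3 / 2 : ℝ) * r) *
      eLpNorm (shiftSum N fun k => f (((k : ℝ) * h : ℝ) : ℂ) / r) 2 volume := by
  have ha : 0 < Real.pi / h := div_pos Real.pi_pos hh
  rw [sincSum_eq f N h hr.ne', eLpNorm_const_smul,
    eLpNorm_two_comp_mul_left (continuous_shiftSum _ _) ha, ← mul_assoc,
    Real.enorm_of_nonneg (by positivity), ← ENNReal.ofReal_mul (by positivity)]
  congr 2
  have : (Real.pi / h) ^ (3 / 2 : ℝ) = (Real.pi / h) ^ 2 * (Real.pi / h) ^ (-(1 / 2) : ℝ) := by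
    rw [← Real.rpow_natCast, ← Real.rpow_add ha]; norm_num
  rw [this]; ring

theorem memLp_sincSum (f : ℂ → ℂ) (N : ℕ) {h : ℝ} (hh : 0 < h) : MemLp (sincSum f N h) 2 := by
  refine ⟨?_, ?_⟩
  · rw [sincSum_eq f N h one_ne_zero]
    exact (((continuous_shiftSum N _).comp (continuous_const.mul continuous_id)).const_smul
      _).aestronglyMeasurable
  · rw [eLpNorm_sincSum f N hh one_pos]
    exact ENNReal.mul_lt_top ENNReal.ofReal_lt_top (memLp_shiftSum N _).2

theorem eLpNorm_shiftSum_ne_zero {N : ℕ} {c : ℤ → ℝ} {v : ℂ} (hv : v ≠ 0) {j : ℤ}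
    (hj : j ∈ Finset.Icc (-(N : ℤ)) N) (hcj : c j ≠ 0) :
    eLpNorm (shiftSum N fun k => v * c k) 2 volume ≠ 0 := by
  intro h0
  rw [eLpNorm_eq_zero_iff (continuous_shiftSum N _).aestronglyMeasurable (by simp)] at h0
  have h1 := (continuous_shiftSum N _).ae_eq_iff_eq volume continuous_const |>.1 h0
  refine hcj (eq_zero_of_sum_iteratedDeriv_two_sinc_eq_zero N c (fun x => ?_) hj)
  have hx := congrFun h1 x
  simp only [shiftSum, mul_assoc, ← Finset.mul_sum] at hx
  exact_mod_cast (mul_eq_zero.1 hx).resolve_left hv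

theorem tendsto_eLpNorm_sincSum {f : ℂ → ℂ} {N : ℕ} {c : ℤ → ℝ} {v : ℂ} (hv : v ≠ 0) {j : ℤ}
    (hj : j ∈ Finset.Icc (-(N : ℤ)) N) (hcj : c j ≠ 0) {r : ℝ → ℝ}
    (hr : ∀ h, 0 < h → 0 < r h)
    (hr_top : Tendsto (fun h => (Real.pi / h) ^ (3 / 2 : ℝ) * r h) (𝓝[>] 0) atTop)
    (hc : ∀ k : ℤ, Tendsto (fun h : ℝ => f (((k : ℝ) * h : ℝ) : ℂ) / r h) (𝓝[>] 0)
      (𝓝 (v * c k))) :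
    Tendsto (fun h => eLpNorm (sincSum f N h) 2 volume) (𝓝[>] 0) (𝓝 ⊤) := by
  set G : ℝ → ℝ → ℂ := fun h => shiftSum N fun k => f (((k : ℝ) * h : ℝ) : ℂ) / r h
  set m := eLpNorm (shiftSum N fun k => v * c k) 2 volume with hm
  have hm0 : m ≠ 0 := eLpNorm_shiftSum_ne_zero hv hj hcj
  have hmtop : m ≠ ⊤ := (memLp_shiftSum N _).2.ne
  have hlim : ∀ x, Tendsto (fun h => G h x) (𝓝[>] 0) (𝓝 (shiftSum N (fun k => v * c k) x)) :=
    fun x => tendsto_finsetSum _ fun k _ => (hc k).mul_const _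
  -- Fatou: were the norm below `m / 2` for arbitrarily small `h`, the pointwise limit along those
  -- `h` would give `m ≤ m / 2`.
  have hev : ∀ᶠ h in 𝓝[>] (0 : ℝ), m / 2 ≤ eLpNorm (G h) 2 volume := by
    by_contra hcon
    rw [not_eventually] at hcon
    set s := {h : ℝ | ¬ m / 2 ≤ eLpNorm (G h) 2 volume}
    have : NeBot (𝓝[>] (0 : ℝ) ⊓ 𝓟 s) := frequently_mem_iff_neBot.1 hcon
    have hle : m ≤ m / 2 := Lp.eLpNorm_le_of_ae_tendsto (u := 𝓝[>] (0 : ℝ) ⊓ 𝓟 s) (f := G)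
      (mem_inf_of_right fun h hh => (not_le.1 hh).le)
      (fun h => (continuous_shiftSum N _).aestronglyMeasurable)
      (Eventually.of_forall fun x => (hlim x).mono_left inf_le_left)
    exact absurd hle (not_le.2 (ENNReal.half_lt_self hm0 hmtop))
  have hmul : Tendsto (fun h => ENNReal.ofReal ((Real.pi / h) ^ (3 / 2 : ℝ) * r h) * (m / 2))
      (𝓝[>] 0) (𝓝 ⊤) := by
    have := ENNReal.Tendsto.mul_const (b := m / 2) (ENNReal.tendsto_ofReal_atTop.comp hr_top)
      (Or.inl ENNReal.top_ne_zero)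
    rwa [ENNReal.top_mul (ENNReal.half_pos hm0).ne'] at this
  refine tendsto_nhds_top_mono hmul ?_
  filter_upwards [hev, self_mem_nhdsWithin] with h h1 h2
  rw [eLpNorm_sincSum f N h2 (hr h h2)]
  gcongr

theorem tendsto_eLpNorm_sincSum_of_differentiableAt {f : ℂ → ℂ} (hf : DifferentiableAt ℂ f 0)
    (hf0 : ¬(f 0 = 0 ∧ deriv f 0 = 0)) {N : ℕ} (hN : 1 ≤ N) :
    Tendsto (fun h => eLpNorm (sincSum f N h) 2 volume) (𝓝[>] 0) (𝓝 ⊤) := by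
  have h1 : (1 : ℤ) ∈ Finset.Icc (-(N : ℤ)) N := by
    rw [Finset.mem_Icc]; omega
  have hpi : Tendsto (fun h : ℝ => Real.pi / h) (𝓝[>] 0) atTop :=
    tendsto_inv_nhdsGT_zero.const_mul_atTop Real.pi_pos
  by_cases h0 : f 0 = 0
  · have hd : deriv f 0 ≠ 0 := fun h => hf0 ⟨h0, h⟩
    -- At a zero of `f` with `f' 0 ≠ 0`, dividing by `h` leaves `k * f' 0`, nonzero at `k = 1`; this
    -- index needs `1 ≤ N`.
    refine tendsto_eLpNorm_sincSum (c := fun k => k) (r := id) hd h1 (by simp)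
      (fun h hh => hh) ?_ fun k => ?_
    · have : Tendsto (fun h : ℝ => (Real.pi / h) ^ (1 / 2 : ℝ) * Real.pi) (𝓝[>] 0) atTop :=
        ((tendsto_rpow_atTop (by norm_num)).comp hpi).atTop_mul_const Real.pi_pos
      refine this.congr' ?_
      filter_upwards [self_mem_nhdsWithin] with h (hh : 0 < h)
      have ha : 0 < Real.pi / h := div_pos Real.pi_pos hh
      rw [show (3 / 2 : ℝ) = 1 / 2 + 1 by norm_num, Real.rpow_add_one ha.ne', mul_assoc, id,
        div_mul_cancel₀ _ hh.ne']
    · have hg : HasDerivAt (fun z : ℂ => f (k * z)) (deriv f 0 * k) 0 := by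
        have hf' : HasDerivAt f (deriv f 0) ((k : ℂ) * 0) := by
          rw [mul_zero]; exact hf.hasDerivAt
        simpa using! hf'.comp (0 : ℂ) ((hasDerivAt_id (0 : ℂ)).const_mul (k : ℂ))
      have hg' : HasDerivAt (fun x : ℝ => f (k * (x : ℂ))) (deriv f 0 * k) 0 :=
        HasDerivAt.comp_ofReal (z := 0) (by simpa using! hg)
      have ht := (hasDerivAt_iff_tendsto_slope.1 hg').mono_left
        (nhdsWithin_mono 0 fun x (hx : 0 < x) => hx.ne')
      refine (ht.congr fun x => ?_).trans (by simp)
      simp [slope, h0, div_eq_inv_mul]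
  · refine tendsto_eLpNorm_sincSum (c := fun _ => 1) (r := fun _ => 1) h0 h1 one_ne_zero
      (fun _ _ => one_pos) ?_ fun k => ?_
    · simpa using! (tendsto_rpow_atTop (by norm_num : (0 : ℝ) < 3 / 2)).comp hpi
    · have hcont : ContinuousAt (fun x : ℝ => f ((k * x : ℝ) : ℂ)) 0 := by
        refine ContinuousAt.comp (f := fun x : ℝ => ((k * x : ℝ) : ℂ)) ?_ (by fun_prop)
        simpa using hf.continuousAt
      have := hcont.tendsto.mono_left (nhdsWithin_le_nhds (s := Set.Ioi 0))
      simpa using this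

/-! ### The error -/

theorem aestronglyMeasurable_iteratedDeriv_two (g : ℝ → ℂ) :
    AEStronglyMeasurable (iteratedDeriv 2 g) := by
  rw [iteratedDeriv_succ]
  exact aestronglyMeasurable_deriv _ _

theorem sincError_eq (f : ℂ → ℂ) (N : ℕ) (h : ℝ) :
    sincError f N h =
      eLpNorm (iteratedDeriv 2 (fun t : ℝ => f (t : ℂ)) - sincSum f N h) 2 volume := rfl

/-- The expansion is always in `L²`, so finiteness of the error does not depend on `h`. -/
theorem sincError_lt_top_iff (f : ℂ → ℂ) (N : ℕ) {h : ℝ} (hh : 0 < h) :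
    sincError f N h < ⊤ ↔ MemLp (iteratedDeriv 2 fun t : ℝ => f (t : ℂ)) 2 := by
  have hm := aestronglyMeasurable_iteratedDeriv_two fun t : ℝ => f (t : ℂ)
  have hs := memLp_sincSum f N hh
  refine ⟨fun hlt => ?_, fun hmem => (hmem.sub hs).2⟩
  have : MemLp (iteratedDeriv 2 (fun t : ℝ => f (t : ℂ)) - sincSum f N h) 2 :=
    ⟨hm.sub hs.1, hlt⟩
  simpa using this.add hs

theorem eventually_sincError_le {f : ℂ → ℂ} (hf : DifferentiableAt ℂ f 0)
    (hf0 : f 0 = 0 → deriv f 0 = 0 → ∀ x : ℝ, f (x : ℂ) = 0) {N : ℕ} (hN : 1 ≤ N)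
    {h₀ : ℝ} (hh₀ : 0 < h₀) :
    ∀ᶠ h in 𝓝[>] (0 : ℝ), sincError f N h₀ ≤ sincError f N h := by
  set F := iteratedDeriv 2 fun t : ℝ => f (t : ℂ) with hF
  by_cases hmem : MemLp F 2
  · by_cases hz : f 0 = 0 ∧ deriv f 0 = 0
    · have hzero := hf0 hz.1 hz.2
      refine Eventually.of_forall fun h => le_of_eq ?_
      simp only [sincError, hzero, zero_mul, Finset.sum_const_zero]
    · have hlt : sincError f N h₀ + eLpNorm F 2 volume < ⊤ :=
        ENNReal.add_lt_top.2 ⟨(sincError_lt_top_iff f N hh₀).2 hmem, hmem.2⟩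
      filter_upwards [(tendsto_eLpNorm_sincSum_of_differentiableAt hf hz hN).eventually_const_lt hlt,
        self_mem_nhdsWithin] with h h1 h2
      have hs := memLp_sincSum f N h2
      have h3 : eLpNorm (sincSum f N h) 2 volume ≤ eLpNorm F 2 volume + sincError f N h := by
        rw [sincError_eq]
        simpa using eLpNorm_sub_le (p := 2) hmem.1 (hmem.1.sub hs.1) (by norm_num)
      rw [add_comm (eLpNorm F 2 volume)] at h3
      exact (ENNReal.add_le_add_iff_right hmem.2.ne).1 (h1.le.trans h3)
  -- If `f''` is not in `L²`, every error is infinite and none is smaller than another.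
  · filter_upwards [self_mem_nhdsWithin] with h hh
    have : sincError f N h = ⊤ := by
      by_contra hne
      exact hmem ((sincError_lt_top_iff f N hh).1 (lt_top_iff_ne_top.2 hne))
    simp [this]

/-! ### The mesh size -/

/-- The bound `w ≤ w * exp w` for `w ≥ 0` is all that is needed to make the mesh size vanish as `B →
∞`. -/
theorem lambertW_mem_Ioc {z : ℝ} (hz : 0 < z) : lambertW z ∈ Set.Ioc 0 z := by
  have hex : ∃ w ∈ Set.Ici (-1 : ℝ), w * Real.exp w = z := by
    have hc : ContinuousOn (fun w : ℝ => w * Real.exp w) (Set.Icc 0 z) := by fun_prop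
    obtain ⟨w, hw, hwz⟩ := intermediate_value_Icc hz.le hc (show z ∈ Set.Icc _ _ from
      ⟨by simpa using hz.le, le_mul_of_one_le_right hz.le (Real.one_le_exp hz.le)⟩)
    exact ⟨w, by simpa using (by linarith [hw.1] : (-1 : ℝ) ≤ w), hwz⟩
  have he : lambertW z * Real.exp (lambertW z) = z := Function.invFunOn_eq hex
  have hpos : 0 < lambertW z := by
    by_contra hle
    have := mul_nonpos_of_nonpos_of_nonneg (not_lt.1 hle) (Real.exp_pos (lambertW z)).le
    linarith
  refine ⟨hpos, ?_⟩
  calc lambertW z ≤ lambertW z * Real.exp (lambertW z) :=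
        le_mul_of_one_le_right hpos.le (Real.one_le_exp hpos.le)
    _ = z := he

theorem meshSize_pos {d γ B : ℝ} {N : ℕ} (hd : 0 < d) (hγ : 0 < γ) (hB : 0 < B) (hN : 1 ≤ N) :
    0 < meshSize d γ B N := by
  have hN' : (0 : ℝ) < N := by exact_mod_cast hN
  exact div_pos (lambertW_mem_Ioc (by positivity)).1 (by positivity)

theorem tendsto_meshSize {d γ : ℝ} {N : ℕ} (hd : 0 < d) (hγ : 0 < γ) (hN : 1 ≤ N) :
    Tendsto (fun B => meshSize d γ B N) atTop (𝓝[>] 0) := by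
  have hN' : (0 : ℝ) < N := by exact_mod_cast hN
  refine tendsto_nhdsWithin_iff.2 ⟨?_, ?_⟩
  · have hlim : Tendsto (fun B : ℝ => Real.pi * d * γ * N / B / (γ * N)) atTop (𝓝 0) := by
      simpa using (tendsto_const_nhds.div_atTop tendsto_id).div_const (γ * N)
    refine squeeze_zero' ?_ ?_ hlim
    · filter_upwards [eventually_gt_atTop 0] with B hB using (meshSize_pos hd hγ hB hN).le
    · filter_upwards [eventually_gt_atTop 0] with B hB
      exact div_le_div_of_nonneg_right (lambertW_mem_Ioc (by positivity)).2 (by positivity)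
  · filter_upwards [eventually_gt_atTop 0] with B hB using meshSize_pos hd hγ hB hN

end SincScaling

theorem mainTheorem2 (f : ℂ → ℂ) (A B γL γR d α : ℝ) (N : ℕ) (BS : ℝ → ℝ)
    (hB : 0 < B) (hγL : 0 < γL) (hγR : 0 < γR) (hN : 1 ≤ N)
    (hleft : ∀ x : ℝ, x ≤ 0 → ‖f (x : ℂ)‖ ≤ A * Real.exp (-B * Real.exp (γL * |x|)))
    (hright : ∀ x : ℝ, 0 ≤ x → ‖f (x : ℂ)‖ ≤ A * Real.exp (-B * Real.exp (γR * |x|)))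
    (hd : 0 < d) (hdγ : d < Real.pi / (2 * max γL γR))
    (hf : SincScaling.MemB 2 d f)
    -- `f` and `f'` do not both vanish at `0`, unless `f` is identically zero
    (hf0 : f 0 = 0 → deriv f 0 = 0 → ∀ x : ℝ, f (x : ℂ) = 0)
    -- scaling by `τ` replaces `B` by `B_S = τ ^ α * B`
    (hBS : ∀ τ : ℝ, 0 < τ → BS τ / τ ^ α = B) :
    -- relative to any scaling factor `τ₀` (the unscaled method is `τ₀ = 1`), the scaling factors
    -- that decrease the error form a bounded set
    ∀ τ₀ : ℝ, 0 < τ₀ →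
      (0 ≤ α → Bornology.IsBounded {τ : ℝ | 0 < τ ∧
        SincScaling.sincError f N (SincScaling.meshSize d (max γL γR) (BS τ) N) <
          SincScaling.sincError f N (SincScaling.meshSize d (max γL γR) (BS τ₀) N)}) ∧
      (α < 0 → ∃ c : ℝ, 0 < c ∧ ∀ τ : ℝ, 0 < τ →
        SincScaling.sincError f N (SincScaling.meshSize d (max γL γR) (BS τ) N) <
          SincScaling.sincError f N (SincScaling.meshSize d (max γL γR) (BS τ₀) N) →
        c ≤ τ) := by
  intro τ₀ hτ₀
  have hγ : 0 < max γL γR := lt_max_of_lt_left hγL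
  have hBS' : ∀ τ : ℝ, 0 < τ → BS τ = B * τ ^ α := fun τ hτ => by
    rw [← hBS τ hτ, div_mul_cancel₀ _ (Real.rpow_pos_of_pos hτ α).ne']
  have hBpos : 0 < BS τ₀ := by rw [hBS' τ₀ hτ₀]; positivity
  have hdiff : DifferentiableAt ℂ f 0 := by
    refine hf.holomorphic.differentiableAt (IsOpen.mem_nhds ?_ ?_)
    · exact isOpen_lt (Complex.continuous_im.abs) continuous_const
    · simpa [SincScaling.strip] using hd
  have hev : ∀ᶠ b in Filter.atTop,
      SincScaling.sincError f N (SincScaling.meshSize d (max γL γR) (BS τ₀) N) ≤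
        SincScaling.sincError f N (SincScaling.meshSize d (max γL γR) b N) :=
    (SincScaling.tendsto_meshSize hd hγ hN).eventually
      (SincScaling.eventually_sincError_le hdiff hf0 hN (SincScaling.meshSize_pos hd hγ hBpos hN))
  refine ⟨fun hα => ?_, fun hα => ?_⟩
  · rcases hα.eq_or_lt with rfl | hα
    -- For `α = 0` scaling leaves `B`, hence the error, unchanged.
    · refine Bornology.isBounded_empty.subset fun τ ⟨hτ, hlt⟩ => ?_
      rw [hBS' τ hτ, hBS' τ₀ hτ₀, Real.rpow_zero, Real.rpow_zero] at hlt
      exact lt_irrefl _ hlt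
    · obtain ⟨M, hM⟩ := Filter.eventually_atTop.1
        (((tendsto_rpow_atTop hα).const_mul_atTop hB).eventually hev)
      refine (Metric.isBounded_Icc 0 M).subset fun τ ⟨hτ, hlt⟩ => ⟨hτ.le, ?_⟩
      by_contra hle
      have := hM τ (not_le.1 hle).le
      rw [← hBS' τ hτ] at this
      exact absurd hlt (not_lt.2 this)
  · have hlim : Filter.Tendsto (fun τ : ℝ => B * τ ^ α) (nhdsWithin 0 (Set.Ioi 0)) Filter.atTop :=
      (tendsto_rpow_neg_nhdsGT_zero hα).const_mul_atTop hB
    obtain ⟨c, hc, hcs⟩ := mem_nhdsGT_iff_exists_Ioo_subset.1 (hlim.eventually hev)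
    refine ⟨c, hc, fun τ hτ hlt => ?_⟩
    by_contra hle
    have := hcs ⟨hτ, not_le.1 hle⟩
    rw [Set.mem_ofPred_eq, ← hBS' τ hτ] at this
    exact absurd hlt (not_lt.2 this)
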